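/- **Theorem 8.** Words are over $\{0,1\}$. An overlap is a finite word $axaxa$ with $a$ a letter and $x$ a possibly empty word; an infinite word is overlap-free if none of its finite factors is an overlap. Let $\mu$ be the Thue–Morse morphism $0\mapsto 01$, $1\mapsto 10$, with fixed points $\mathbf t=\mu^\omega(0)$ and $\overline{\mathbf t}=\mu^\omega(1)$, and let $p_0=\epsilon$, $p_1=0$, $p_2=00$, $p_3=1$, $p_4=11$. A code of an infinite word $\mathbf x$ is a sequence $\mathbf i=(i_j)_{j\ge1}$ over $\{0,1,2,3,4\}$ with $$\mathbf x=p_{i_1}\,\mu(p_{i_2}\,\mu(p_{i_3}\,\mu(\cdots))),$$ that is, such that there are infinite words $\mathbf y_1=\mathbf x,\mathbf y_2,\mathbf y_3,\dots$ with $\mathbf y_j=p_{i_j}\,\mu(\mathbf y_{j+1})$ for all $j\ge 1$; exactly if $\mathbf i$ ends in $0^\omega$, the code contains in addition an element telling whether this tail represents $\mathbf t$ (written $\mathbf i;1$) or $\overline{\mathbf t}$ (written $\mathbf i;3$). Consider the automaton with states $A,\dots,K$, initial state $A$, and transitions - $A$: $0\to A$, $1\to B$, $2\to C$, $3\to D$,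 $4\to E$; - $B$: $0\to D$, $1\to B$, $3\to E$; - $C$: $0\to F$, $3\to E$; - $D$: $0\to B$, $1\to C$, $3\to D$; - $E$: $0\to I$, $1\to C$; - $F$: $3\to G$; - $G$: $0\to H$, $3\to D$; - $H$: $0\to G$, $3\to E$; - $I$: $1\to J$; - $J$: $0\to K$, $1\to B$; - $K$: $0\to J$, $1\to C$. A code is specified by the automaton if its sequence $\mathbf i$ labels an infinite path starting in $A$ and, in case $\mathbf i$ ends in $0^\omega$, the tail is $\mathbf t$ if the path ends in the cycle between $J$ and $K$, and $\overline{\mathbf t}$ if it ends in the cycle between $G$ and $H$ (either is allowed on the cycle on $A$ and on the cycle between $B$ and $D$). Every infinite binary overlap-free word $\mathbf x$ has exactly one code, and $\mathbf x=(x_n)_{n\ge0}$ is $2$-automatic (that is, there is a deterministic finite automaton with output which, on input the base-$2$ expansion of $n$, outputs $x_n$ for every $n\ge 0$) if and only if its code is both specified by the automaton above and ultimately periodic (that is, the sequence $\mathbf i$ is ultimately periodic). -/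

import Mathlib

namespace OverlapFreeWords

/-- A finite word is an overlap if it has the form `a x a x a`, with `a` a letter and `x` a
(possibly empty) word. -/
def IsOverlap {α : Type*} (w : List α) : Prop :=
  ∃ (a : α) (x : List α), w = [a] ++ x ++ [a] ++ x ++ [a]

/-- The factor of length `m` of the infinite word `x` that starts at position `k`. -/
def factor {α : Type*} (x : ℕ → α) (k m : ℕ) : List α :=
  (List.range m).map fun j => x (k + j)

/-- An infinite word is overlap-free if none of its finite factors is an overlap. -/
def OverlapFree {α : Type*} (x : ℕ → α) : Prop :=
  ∀ k m : ℕ, ¬ IsOverlap (factor x k m)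

/-- An infinite word is ultimately periodic if it has the form `y z z z ⋯` with `z` nonempty. -/
def UltimatelyPeriodic {α : Type*} (s : ℕ → α) : Prop :=
  ∃ N p : ℕ, 0 < p ∧ ∀ n, N ≤ n → s (n + p) = s n

/-- Deterministic automata with output, with input alphabet `Fin k`, output alphabet `Δ` and set
of states `σ`. -/
structure DFAO (k : ℕ) (Δ : Type*) (σ : Type*) where
  /-- the transition function -/
  step : σ → Fin k → σ
  /-- the initial state -/
  start : σ
  /-- the output associated with a state -/
  output : σ → Δ

/-- The output associated with the state last visited on the input `w`. -/
def DFAO.eval {k : ℕ} {Δ : Type*} {σ : Type*} (M : DFAO k Δ σ) (w : List (Fin k)) : Δ :=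
  M.output (w.foldl M.step M.start)

/-- The base-`k` expansion of `n`, most significant digit first, without leading zeros (so that
`0` has the empty expansion). -/
def expansion (k : ℕ) [NeZero k] (n : ℕ) : List (Fin k) :=
  (Nat.digits k n).reverse.map (Fin.ofNat k)

/-- The infinite word `a` is `k`-automatic: some finite automaton with output computes `a n` from
the base-`k` expansion of `n`. -/
def IsAutomatic (k : ℕ) [NeZero k] {Δ : Type*} (a : ℕ → Δ) : Prop :=
  ∃ (σ : Type) (_ : Finite σ) (M : DFAO k Δ σ), ∀ n : ℕ, M.eval (expansion k n) = a n

/-! Binary words are words over `Bool`, with `false` the letter `0` and `true` the letter `1`. -/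

/-- The infinite word `l x`, for a finite word `l` and an infinite word `x`. -/
def prepend (l : List Bool) (x : ℕ → Bool) : ℕ → Bool :=
  fun n => if h : n < l.length then l[n] else x (n - l.length)

/-- The Thue-Morse morphism `0 ↦ 01`, `1 ↦ 10` on infinite words: the letters at positions `2 n`
and `2 n + 1` of the image of `x` are `x n` and its complement. -/
def mu (x : ℕ → Bool) : ℕ → Bool :=
  fun n => if n % 2 = 0 then x (n / 2) else !(x (n / 2))

/-- `z` is the fixed point of the Thue-Morse morphism that starts with the letter `a`: the
Thue-Morse word if `a` is `0`, its complement if `a` is `1`. -/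
def IsThueMorse (a : Bool) (z : ℕ → Bool) : Prop :=
  mu z = z ∧ z 0 = a

/-- The words `p₀ = ε`, `p₁ = 0`, `p₂ = 00`, `p₃ = 1`, `p₄ = 11`. -/
def p : Fin 5 → List Bool :=
  ![[], [false], [false, false], [true], [true, true]]

/-- The sequence is `0` from position `m` on. -/
def ZeroFrom (i : ℕ → Fin 5) (m : ℕ) : Prop :=
  ∀ n, m ≤ n → i n = 0

/-- Codes: an infinite sequence of indices and, exactly if that sequence ends in `000⋯`, an
additional element that tells the two fixed points of the Thue-Morse morphism apart
(`some false` for the Thue-Morse word, `some true` for its complement). -/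
@[ext]
structure Code where
  /-- the sequence of indices -/
  index : ℕ → Fin 5
  /-- the additional element -/
  tail : Option Bool
  tail_isSome_iff : tail.isSome = true ↔ ∃ m, ZeroFrom index m

/-- `c` is a code of `x`: we have `x = p_{i₀} μ(p_{i₁} μ(p_{i₂} μ(⋯)))`, where `i` is the index
sequence of `c`, and `y j` is the infinite word represented by the part of the expression that
starts with `p_{i_j}`; if `i` ends in `000⋯`, then this tail represents the fixed point of the
Thue-Morse morphism which the additional element of `c` names. -/
def Code.Encodes (c : Code) (x : ℕ → Bool) : Prop :=
  ∃ y : ℕ → ℕ → Bool, y 0 = x ∧ (∀ j, y j = prepend (p (c.index j)) (mu (y (j + 1)))) ∧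
    ∀ a, c.tail = some a → ∀ m, ZeroFrom c.index m → IsThueMorse a (y m)

/-- The states of the automaton. -/
inductive State
  | A | B | C | D | E | F | G | H | I | J | K

/-- The (partial) transition function of the automaton. -/
def State.next : State → Fin 5 → Option State
  | .A, 0 => some .A
  | .A, 1 => some .B
  | .A, 2 => some .C
  | .A, 3 => some .D
  | .A, 4 => some .E
  | .B, 0 => some .D
  | .B, 1 => some .B
  | .B, 3 => some .E
  | .C, 0 => some .F
  | .C, 3 => some .E
  | .D, 0 => some .B
  | .D, 1 => some .C
  | .D, 3 => some .D
  | .E, 0 => some .I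
  | .E, 1 => some .C
  | .F, 3 => some .G
  | .G, 0 => some .H
  | .G, 3 => some .D
  | .H, 0 => some .G
  | .H, 3 => some .E
  | .I, 1 => some .J
  | .J, 0 => some .K
  | .J, 1 => some .B
  | .K, 0 => some .J
  | .K, 1 => some .C
  | _, _ => none

/-- `c` is specified by the automaton: its index sequence labels an infinite path that starts in
`A`, and, if that path ends in `000⋯`, the additional element is one that the final cycle allows:
the Thue-Morse word on the cycle between `J` and `K`, its complement on the cycle between `G` and
`H`, either of them on the cycle on `A` and on the cycle between `B` and `D`. -/
def Code.Specified (c : Code) : Prop :=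
  ∃ q : ℕ → State, q 0 = .A ∧ (∀ n, (q n).next (c.index n) = some (q (n + 1))) ∧
    ∀ m, ZeroFrom c.index m →
      ((q m = .J ∨ q m = .K) → c.tail = some false) ∧
      ((q m = .G ∨ q m = .H) → c.tail = some true)

end OverlapFreeWords

/-!
In an overlap-free word the squares of letters, apart from one at the very beginning, stand at
positions of one parity (`OverlapFree.ne_of_odd_dist`). Hence the word is `p_i μ(y)` for exactly one
`i` and one `y`, and `y` is overlap-free again (`OverlapFree.exists_eq_prepend_mu`,
`OverlapFree.prepend_mu_inj`). Iterating gives the code and its uniqueness; a tail `000⋯` yields a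
fixed point of `μ`, which is known by its first letter.

Each state of the automaton stands for a set of infinite words, given by `State.Holds`: the words
that remain overlap-free after a certain letter is put in front, sometimes with prescribed first
letters. If `p_i μ(y)` lies in the set of a state, then the transition `i` is defined there and `y`
lies in the set of the next state (`State.Holds.exists_next`). So the code of every overlap-free
word is specified by the automaton, and what remains is that `x` is automatic if and only if its
sequence of indices is ultimately periodic.

Let `y j` be the word represented by the code from index `j` on. It is a progression
`y j n = x (2 ^ j * n + r)` with `r < 2 ^ (j + 1)`, and an automatic word has only finitely many of
these (`IsAutomatic.finite_progressions`). So two of the `y j` coincide if `x` is automatic, and by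
uniqueness the indices repeat from there on. Conversely, if the indices are ultimately periodic,
then there are finitely many `y j`, because the indices and the choice of the tail determine the word
(`IsExpansion.unique`). The words that agree with some `y j` or its complement up to at most two
letters at the beginning then form a finite set closed under passing to the letters at even or odd
positions, which suffices for automaticity (`isAutomatic_of_finite`).
-/

namespace OverlapFreeWords

/-! ### Overlaps as periods -/

/-- An overlap is a word of length `2 n + 1` and period `n`, for some `n > 0`. -/
theorem overlapFree_iff {α : Type*} {x : ℕ → α} :
    OverlapFree x ↔ ∀ k n, 0 < n → ¬ ∀ i ≤ n, x (k + i) = x (k + i + n) := by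
  constructor
  · intro h k n hn hper
    refine h k (2 * n + 1) ⟨x k, factor x (k + 1) (n - 1), ?_⟩
    obtain ⟨n, rfl⟩ : ∃ m, n = m + 1 := ⟨n - 1, by omega⟩
    apply List.ext_getElem
    · simp [factor]; omega
    · intro i h1 h2
      simp only [factor, List.length_map, List.length_range] at h1
      simp only [factor, List.getElem_append, List.getElem_map, List.getElem_range,
        List.length_append, List.length_map, List.length_range, List.length_singleton,
        List.getElem_singleton, Nat.add_sub_cancel]
      split_ifs with h3 h4 h5 h6
      · congr 1; omega
      · congr 1; omega
      · have := hper 0 (by omega)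
        rw [Nat.add_zero] at this
        rw [this]; congr 1; omega
      · have := hper (i - (n + 1)) (by omega)
        rw [show k + 1 + (i - (1 + n + 1)) = k + (i - (n + 1)) by omega, this]
        congr 1; omega
      · have h1 := hper 0 (by omega)
        have h2 := hper (n + 1) le_rfl
        simp only [Nat.add_zero] at h1
        rw [h1, h2]
        congr 1; omega
  · rintro h k m ⟨a, w, hw⟩
    have hlen := congrArg List.length hw
    simp only [factor, List.length_map, List.length_range, List.length_append,
      List.length_singleton] at hlen
    have key : ∀ i, i < m → some (x (k + i)) = ([a] ++ w ++ [a] ++ w ++ [a])[i]? := by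
      intro i hi
      rw [← hw]
      simp [factor, hi]
    refine h k (w.length + 1) (by omega) fun i hi => ?_
    have e1 := key i (by omega)
    have e2 := key (i + (w.length + 1)) (by omega)
    apply Option.some_injective
    rw [add_assoc, e1, e2]
    grind

section Windows

variable {x : ℕ → Bool}

theorem OverlapFree.not_period_one (h : OverlapFree x) (k : ℕ) :
    ¬ (x k = x (k + 1) ∧ x (k + 1) = x (k + 2)) := by
  rintro ⟨h0, h1⟩
  refine overlapFree_iff.1 h k 1 one_pos fun i hi => ?_
  interval_cases i <;> assumption

theorem OverlapFree.not_period_two (h : OverlapFree x) (k : ℕ) :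
    ¬ (x k = x (k + 2) ∧ x (k + 1) = x (k + 3) ∧ x (k + 2) = x (k + 4)) := by
  rintro ⟨h0, h1, h2⟩
  refine overlapFree_iff.1 h k 2 two_pos fun i hi => ?_
  interval_cases i <;> assumption

theorem OverlapFree.not_period_three (h : OverlapFree x) (k : ℕ) :
    ¬ (x k = x (k + 3) ∧ x (k + 1) = x (k + 4) ∧ x (k + 2) = x (k + 5) ∧
      x (k + 3) = x (k + 6)) := by
  rintro ⟨h0, h1, h2, h3⟩
  refine overlapFree_iff.1 h k 3 three_pos fun i hi => ?_
  interval_cases i <;> assumption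

theorem OverlapFree.shift (h : OverlapFree x) (l : ℕ) : OverlapFree fun n => x (n + l) := by
  rw [overlapFree_iff] at h ⊢
  intro k n hn hper
  refine h (k + l) n hn fun i hi => ?_
  have := hper i hi
  convert this using 2 <;> omega

end Windows

/-! ### The Thue-Morse morphism and prefixes -/

@[simp] theorem mu_two_mul (x : ℕ → Bool) (n : ℕ) : mu x (2 * n) = x n := by
  simp [mu]

@[simp] theorem mu_two_mul_add_one (x : ℕ → Bool) (n : ℕ) : mu x (2 * n + 1) = !x n := by
  simp [mu, Nat.add_mod, show (2 * n + 1) / 2 = n by omega]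

@[simp] theorem prepend_nil (x : ℕ → Bool) : prepend [] x = x := by
  funext n; simp [prepend]

@[simp] theorem prepend_cons_zero (a : Bool) (l : List Bool) (x : ℕ → Bool) :
    prepend (a :: l) x 0 = a := by
  simp [prepend]

@[simp] theorem prepend_cons_succ (a : Bool) (l : List Bool) (x : ℕ → Bool) (n : ℕ) :
    prepend (a :: l) x (n + 1) = prepend l x n := by
  simp [prepend]

theorem prepend_cons (a : Bool) (l : List Bool) (x : ℕ → Bool) :
    prepend (a :: l) x = prepend [a] (prepend l x) := by
  funext n; cases n <;> simp

theorem prepend_add_length (l : List Bool) (x : ℕ → Bool) (n : ℕ) :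
    prepend l x (n + l.length) = x n := by
  simp [prepend]

theorem length_p_le (i : Fin 5) : (p i).length ≤ 2 := by
  fin_cases i <;> simp [p]

theorem OverlapFree.of_prepend {l : List Bool} {x : ℕ → Bool} (h : OverlapFree (prepend l x)) :
    OverlapFree x := by
  have := h.shift l.length
  simpa only [prepend_add_length] using this

/-- An overlap at position `k` in `y` gives an overlap at position `2 k + 1` in `μ(y)`, because the
image of an overlap of period `n` has length `4 n + 2`, one more than an overlap of period `2 n`
needs. The first letter of `μ(y)` is thus not needed to see that `y` is overlap-free. -/
theorem OverlapFree.of_tail_mu {y : ℕ → Bool} (h : OverlapFree fun n => mu y (n + 1)) :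
    OverlapFree y := by
  rw [overlapFree_iff] at h ⊢
  intro k n hn hper
  refine h (2 * k) (2 * n) (by omega) fun i hi => ?_
  rcases Nat.even_or_odd' i with ⟨j, rfl | rfl⟩
  · have := hper j (by omega)
    rw [show 2 * k + 2 * j + 1 = 2 * (k + j) + 1 by ring,
      show 2 * k + 2 * j + 2 * n + 1 = 2 * (k + j + n) + 1 by ring]
    simp [this]
  · have := hper (j + 1) (by omega)
    rw [show 2 * k + (2 * j + 1) + 1 = 2 * (k + (j + 1)) by ring,
      show 2 * k + (2 * j + 1) + 2 * n + 1 = 2 * (k + (j + 1) + n) by ring]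
    simp [this]

theorem OverlapFree.of_mu {y : ℕ → Bool} (h : OverlapFree (mu y)) : OverlapFree y :=
  (h.shift 1).of_tail_mu

theorem mu_prepend (a : Bool) (y : ℕ → Bool) :
    mu (prepend [a] y) = prepend [a, !a] (mu y) := by
  funext n
  rcases Nat.even_or_odd' n with ⟨j, rfl | rfl⟩
  · rw [mu_two_mul]
    cases j with
    | zero => simp
    | succ j => simp [show 2 * (j + 1) = 2 * j + 1 + 1 by ring]
  · rw [mu_two_mul_add_one]
    cases j with
    | zero => simp
    | succ j => simp [show 2 * (j + 1) + 1 = 2 * j + 1 + 1 + 1 by ring]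

/-! ### Desubstitution of overlap-free words -/

/-- In an overlap-free word, the squares of letters that do not stand at the very beginning occur
at positions of the same parity. -/
theorem OverlapFree.ne_of_odd_dist {x : ℕ → Bool} (h : OverlapFree x) {k : ℕ}
    (hk : x (k + 1) = x (k + 2)) (d : ℕ) : x (k + 2 * d + 2) ≠ x (k + 2 * d + 3) := by
  induction d using Nat.strong_induction_on generalizing k with
  | _ d ih =>
  have one : x (k + 2) ≠ x (k + 3) := fun e => h.not_period_one (k + 1) ⟨hk, e⟩
  -- Here `b a a b a a b` would occur at position `k`: the letter before the first square is used.
  have three : x (k + 4) ≠ x (k + 5) := by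
    intro e
    have h0 := h.not_period_one k
    have h3 := h.not_period_one (k + 3)
    have h4 := h.not_period_one (k + 4)
    have h' := h.not_period_three k
    have key : ∀ a b c d e f g : Bool, b = c → e = f → ¬(a = b ∧ b = c) → ¬(d = e ∧ e = f) →
        ¬(e = f ∧ f = g) → c ≠ d → ¬(a = d ∧ b = e ∧ c = f ∧ d = g) → False := by decide
    exact key _ _ _ _ _ _ _ hk e h0 h3 h4 one h'
  match d with
  | 0 => exact one
  | 1 => exact three
  | d + 2 =>
    by_cases h2 : x (k + 3) = x (k + 4)
    · have := ih (d + 1) (by omega) (k := k + 2) h2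
      rwa [show k + 2 + 2 * (d + 1) = k + 2 * (d + 2) by ring] at this
    · have h4 : x (k + 5) = x (k + 6) := by
        have h' := h.not_period_two (k + 2)
        have key : ∀ a b c d e : Bool, a ≠ b → b ≠ c → c ≠ d →
            ¬(a = c ∧ b = d ∧ c = e) → d = e := by decide
        exact key _ _ _ _ _ one h2 three h'
      have := ih d (by omega) (k := k + 4) h4
      rwa [show k + 4 + 2 * d = k + 2 * (d + 2) by ring] at this

theorem eq_mu_of_ne {x : ℕ → Bool} (h : ∀ n, x (2 * n) ≠ x (2 * n + 1)) :
    x = mu fun n => x (2 * n) := by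
  funext n
  rcases Nat.even_or_odd' n with ⟨j, rfl | rfl⟩
  · simp
  · have := h j
    rw [mu_two_mul_add_one]
    exact Bool.eq_not_of_ne this.symm

theorem eq_prepend_of_take {x : ℕ → Bool} (l : List Bool) (z : ℕ → Bool)
    (h1 : ∀ n (hn : n < l.length), x n = l[n]) (h2 : (fun n => x (n + l.length)) = z) :
    x = prepend l z := by
  subst h2
  funext n
  unfold prepend
  split_ifs with hn
  · exact h1 n hn
  · congr 1; omega

theorem OverlapFree.exists_eq_prepend_mu {x : ℕ → Bool} (h : OverlapFree x) :
    ∃ (i : Fin 5) (y : ℕ → Bool), OverlapFree y ∧ x = prepend (p i) (mu y) := by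
  suffices ∃ (i : Fin 5) (y : ℕ → Bool), x = prepend (p i) (mu y) by
    obtain ⟨i, y, rfl⟩ := this
    exact ⟨i, y, h.of_prepend.of_mu, rfl⟩
  by_cases hodd : ∀ n, x (2 * n + 1) ≠ x (2 * n + 2)
  · -- All squares after the first letter stand at even positions.
    have e : (fun n => x (n + 1)) = mu fun n => x (2 * n + 1) :=
      eq_mu_of_ne (x := fun n => x (n + 1)) hodd
    cases h0 : x 0
    · exact ⟨1, _, eq_prepend_of_take _ _ (by simp [p, h0]) e⟩
    · exact ⟨3, _, eq_prepend_of_take _ _ (by simp [p, h0]) e⟩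
  · push Not at hodd
    obtain ⟨m, hm⟩ := hodd
    have heven : ∀ n, x (2 * n + 2) ≠ x (2 * n + 3) := by
      intro n hn
      rcases le_or_gt m n with hmn | hmn
      · refine h.ne_of_odd_dist hm (n - m) ?_
        rwa [show 2 * m + 2 * (n - m) = 2 * n by omega]
      · refine h.ne_of_odd_dist (k := 2 * n + 1) hn (m - n - 1) ?_
        rwa [show 2 * n + 1 + 2 * (m - n - 1) + 2 = 2 * m + 1 by omega,
          show 2 * n + 1 + 2 * (m - n - 1) + 3 = 2 * m + 2 by omega]
    by_cases h01 : x 0 = x 1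
    · have e : (fun n => x (n + 2)) = mu fun n => x (2 * n + 2) :=
        eq_mu_of_ne (x := fun n => x (n + 2)) heven
      cases h0 : x 0
      · refine ⟨2, _, eq_prepend_of_take _ _ (fun n hn => ?_) e⟩
        have : n < 2 := hn
        interval_cases n <;> simp [p, h0, ← h01]
      · refine ⟨4, _, eq_prepend_of_take _ _ (fun n hn => ?_) e⟩
        have : n < 2 := hn
        interval_cases n <;> simp [p, h0, ← h01]
    · refine ⟨0, fun n => x (2 * n), ?_⟩
      simp only [p, Matrix.cons_val_zero, prepend_nil]
      refine eq_mu_of_ne fun n => ?_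
      cases n with
      | zero => exact h01
      | succ n => exact heven n

theorem prepend_mu_two_mul_add {l : List Bool} {y : ℕ → Bool} (n : ℕ) :
    prepend l (mu y) (2 * n + l.length) = y n := by
  rw [prepend_add_length, mu_two_mul]

theorem prepend_mu_two_mul_add_one {l : List Bool} {y : ℕ → Bool} (n : ℕ) :
    prepend l (mu y) (2 * n + l.length + 1) = !y n := by
  rw [show 2 * n + l.length + 1 = 2 * n + 1 + l.length by ring, prepend_add_length,
    mu_two_mul_add_one]

/-- Two prefixes whose lengths have different parity would make the word alternate from some point
on; prefixes whose lengths have the same parity are told apart by the first two letters. -/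
theorem OverlapFree.prepend_mu_inj {x : ℕ → Bool} (h : OverlapFree x) {i i' : Fin 5}
    {y y' : ℕ → Bool} (e : x = prepend (p i) (mu y)) (e' : x = prepend (p i') (mu y')) :
    i = i' ∧ y = y' := by
  have hi : i = i' := by
    have alt : ∀ n, x (2 * n + (p i).length) ≠ x (2 * n + (p i).length + 1) := by
      intro n
      rw [e, prepend_mu_two_mul_add, prepend_mu_two_mul_add_one]; simp
    have alt' : ∀ n, x (2 * n + (p i').length) ≠ x (2 * n + (p i').length + 1) := by
      intro n
      rw [e', prepend_mu_two_mul_add, prepend_mu_two_mul_add_one]; simp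
    have h2 := h.not_period_two 2
    have a0 := alt 0; have a1 := alt 1; have a2 := alt 2
    have b0 := alt' 0; have b1 := alt' 1; have b2 := alt' 2
    have z0 := congrFun e 0; have z1 := congrFun e 1
    have z0' := congrFun e' 0; have z1' := congrFun e' 1
    clear e e' alt alt' h
    fin_cases i <;> fin_cases i' <;> simp [p, prepend] at * <;> grind
  subst hi
  refine ⟨rfl, funext fun n => ?_⟩
  rw [← prepend_mu_two_mul_add (l := p i) (y := y) n, ← e, e', prepend_mu_two_mul_add]

/-! ### Existence and uniqueness of codes -/

/-- The words `y j` are represented by the tails of the expression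
`p_{i₀} μ(p_{i₁} μ(p_{i₂} μ(⋯)))`. -/
def IsExpansion (i : ℕ → Fin 5) (y : ℕ → ℕ → Bool) : Prop :=
  ∀ j, y j = prepend (p (i j)) (mu (y (j + 1)))

theorem IsExpansion.shift {i : ℕ → Fin 5} {y : ℕ → ℕ → Bool} (h : IsExpansion i y) (m : ℕ) :
    IsExpansion (fun j => i (j + m)) (fun j => y (j + m)) := by
  intro j
  have := h (j + m)
  rwa [show j + m + 1 = j + 1 + m by ring] at this

theorem IsExpansion.overlapFree {i : ℕ → Fin 5} {y : ℕ → ℕ → Bool} (h : IsExpansion i y)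
    (h0 : OverlapFree (y 0)) (j : ℕ) : OverlapFree (y j) := by
  induction j with
  | zero => exact h0
  | succ j ih =>
    rw [h j] at ih
    exact ih.of_prepend.of_mu

theorem OverlapFree.exists_isExpansion {x : ℕ → Bool} (h : OverlapFree x) :
    ∃ i y, y 0 = x ∧ IsExpansion i y := by
  have step : ∀ z : {z : ℕ → Bool // OverlapFree z}, ∃ (i : Fin 5)
      (y : {z : ℕ → Bool // OverlapFree z}), z.1 = prepend (p i) (mu y.1) := by
    rintro ⟨z, hz⟩
    obtain ⟨i, y, hy, e⟩ := hz.exists_eq_prepend_mu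
    exact ⟨i, ⟨y, hy⟩, e⟩
  choose f g hfg using step
  refine ⟨fun j => f (g^[j] ⟨x, h⟩), fun j => (g^[j] ⟨x, h⟩).1, rfl, fun j => ?_⟩
  simp only [Function.iterate_succ_apply']
  exact hfg _

theorem IsExpansion.eq_of_zeroFrom {i : ℕ → Fin 5} {y : ℕ → ℕ → Bool} (h : IsExpansion i y) {m : ℕ}
    (hm : ZeroFrom i m) {j : ℕ} (hj : m ≤ j) : y j = mu (y (j + 1)) := by
  have := h j
  rwa [hm j hj, show p 0 = [] from rfl, prepend_nil] at this

/-- A sequence of words, each the image under `μ` of the next one, is constant. -/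
theorem IsExpansion.succ_eq_of_zeroFrom {i : ℕ → Fin 5} {y : ℕ → ℕ → Bool} (h : IsExpansion i y)
    {m : ℕ} (hm : ZeroFrom i m) {j : ℕ} (hj : m ≤ j) : y (j + 1) = y j := by
  funext n
  induction n using Nat.strong_induction_on generalizing j with
  | _ n ih =>
  rw [h.eq_of_zeroFrom hm (by omega : m ≤ j + 1), h.eq_of_zeroFrom hm hj]
  rcases Nat.eq_zero_or_pos n with rfl | hn
  · have e : ∀ k, m ≤ k → y (k + 1) 0 = y k 0 := by
      intro k hk
      rw [h.eq_of_zeroFrom hm hk]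
      simp [mu]
    simp [mu, e (j + 1) (by omega)]
  · simp only [mu]
    rw [ih (n / 2) (by omega) (by omega : m ≤ j + 1)]

theorem IsExpansion.add_eq_of_zeroFrom {i : ℕ → Fin 5} {y : ℕ → ℕ → Bool} (h : IsExpansion i y)
    {m : ℕ} (hm : ZeroFrom i m) (k : ℕ) : y (m + k) = y m := by
  induction k with
  | zero => rfl
  | succ k ih => rw [← ih, ← add_assoc, h.succ_eq_of_zeroFrom hm (by omega)]

theorem IsExpansion.isThueMorse {i : ℕ → Fin 5} {y : ℕ → ℕ → Bool} (h : IsExpansion i y)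
    {m : ℕ} (hm : ZeroFrom i m) : IsThueMorse (y m 0) (y m) := by
  refine ⟨?_, rfl⟩
  have := h.eq_of_zeroFrom hm le_rfl
  rwa [h.succ_eq_of_zeroFrom hm le_rfl, eq_comm] at this

/-- The sequence of indices determines the word, except that a tail `000⋯` leaves the choice between
two words, which differ in the first letter. -/
theorem IsExpansion.unique {i : ℕ → Fin 5} {y y' : ℕ → ℕ → Bool} (h : IsExpansion i y)
    (h' : IsExpansion i y') (h0 : ∀ m, ZeroFrom i m → y m 0 = y' m 0) : y = y' := by
  have first : ∀ j, y j 0 = y' j 0 := by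
    intro j
    by_cases hj : ZeroFrom i j
    · exact h0 j hj
    -- The first letter of `y j` is the first letter of the next nonempty `p`.
    · simp only [ZeroFrom, not_forall] at hj
      obtain ⟨n, hjn, hn⟩ := hj
      obtain ⟨d, rfl⟩ := Nat.exists_eq_add_of_le hjn
      clear hjn
      induction d generalizing j with
      | zero =>
        rw [h j, h' j]
        have : 0 < (p (i j)).length := by
          rw [add_zero] at hn
          revert hn
          generalize i j = a
          fin_cases a <;> simp [p]
        simp [prepend, this]
      | succ d ih =>
        have := ih (j + 1) (by rwa [show j + 1 + d = j + (d + 1) by ring])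
        rw [h j, h' j]
        simp [prepend, mu, this]
  suffices ∀ n j, y j n = y' j n from funext fun j => funext fun n => this n j
  intro n
  induction n using Nat.strong_induction_on with
  | _ n ih =>
  intro j
  rcases Nat.eq_zero_or_pos n with rfl | hn
  · exact first j
  · rw [h j, h' j]
    simp only [prepend, mu]
    rw [ih ((n - (p (i j)).length) / 2) (by omega)]

theorem existsUnique_code {x : ℕ → Bool} (hx : OverlapFree x) : ∃! c : Code, c.Encodes x := by
  classical
  refine existsUnique_of_exists_of_unique ?_ ?_
  · obtain ⟨i, y, h0, hy⟩ := hx.exists_isExpansion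
    let t : Option Bool := if h : ∃ m, ZeroFrom i m then some (y h.choose 0) else none
    refine ⟨⟨i, t, ?_⟩, y, h0, hy, ?_⟩
    · by_cases h : ∃ m, ZeroFrom i m <;> simp [t, h]
    · intro a ha m hm
      have hex : ∃ m, ZeroFrom i m := ⟨m, hm⟩
      have ha : y hex.choose 0 = a := by simpa [t, hex] using ha
      have e : y m = y hex.choose := by
        rw [← hy.add_eq_of_zeroFrom hm hex.choose, add_comm,
          hy.add_eq_of_zeroFrom hex.choose_spec m]
      rw [← ha, ← e]
      exact hy.isThueMorse hm
  · rintro c c' ⟨y, h0, hy, ht⟩ ⟨y', h0', hy', ht'⟩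
    have hof := IsExpansion.overlapFree hy (h0 ▸ hx)
    have heq : ∀ j, y j = y' j := by
      intro j
      induction j with
      | zero => rw [h0, h0']
      | succ j ih => exact ((hof j).prepend_mu_inj (hy j) (ih.trans (hy' j))).2
    have hidx : c.index = c'.index := funext fun j =>
      ((hof j).prepend_mu_inj (hy j) ((heq j).trans (hy' j))).1
    refine Code.ext hidx ?_
    by_cases h : ∃ m, ZeroFrom c.index m
    · obtain ⟨a, ha⟩ := Option.isSome_iff_exists.1 (c.tail_isSome_iff.2 h)
      obtain ⟨a', ha'⟩ := Option.isSome_iff_exists.1 (c'.tail_isSome_iff.2 (hidx ▸ h))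
      obtain ⟨m, hm⟩ := h
      rw [ha, ha', ← (ht a ha m hm).2, ← (ht' a' ha' m (hidx ▸ hm)).2, heq m]
    · have h1 : ¬ c.tail.isSome = true := fun e => h (c.tail_isSome_iff.1 e)
      have h2 : ¬ c'.tail.isSome = true := fun e => h (hidx ▸ c'.tail_isSome_iff.1 e)
      rw [Option.not_isSome_iff_eq_none] at h1 h2
      rw [h1, h2]

/-! ### The automaton specifies all codes -/

/-- The set of infinite words that is attached to a state: if the path labelled by the code of an
overlap-free word reaches the state after `j` steps, then the word `y j` of the expansion lies in
this set. -/
def State.Holds : State → (ℕ → Bool) → Prop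
  | .A, x => OverlapFree x
  | .B, x => OverlapFree (prepend [true] x)
  | .C, x => OverlapFree (prepend [true] x) ∧ x 0 = true ∧ x 1 = false ∧ x 2 = true
  | .D, x => OverlapFree (prepend [false] x)
  | .E, x => OverlapFree (prepend [false] x) ∧ x 0 = false ∧ x 1 = true ∧ x 2 = false
  | .F, x => OverlapFree (prepend [false] x) ∧ x 0 = true ∧ x 1 = true
  | .G, x => OverlapFree (prepend [false] x) ∧ x 0 = true
  | .H, x => OverlapFree (prepend [true] x) ∧ x 0 = true
  | .I, x => OverlapFree (prepend [true] x) ∧ x 0 = false ∧ x 1 = false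
  | .J, x => OverlapFree (prepend [true] x) ∧ x 0 = false
  | .K, x => OverlapFree (prepend [false] x) ∧ x 0 = false

section Prefixes

variable {y : ℕ → Bool}

/-- If `b` is the complement of `a`, then `a μ(y)` is `μ(b y)` without its first letter. -/
theorem OverlapFree.of_cons_mu {a b : Bool} (h : OverlapFree (prepend [a] (mu y)))
    (hb : b = !a) : OverlapFree (prepend [b] y) := by
  refine OverlapFree.of_tail_mu ?_
  subst hb
  rw [mu_prepend, Bool.not_not]
  simpa only [prepend_cons_succ] using h

theorem OverlapFree.of_cons_not_cons_mu {a b : Bool} (h : OverlapFree (prepend [a, b] (mu y)))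
    (hb : b = !a) : OverlapFree (prepend [a] y) := by
  subst hb
  rw [← mu_prepend] at h
  exact h.of_mu

theorem not_overlapFree_cons_cons_cons (a : Bool) (x : ℕ → Bool) :
    ¬ OverlapFree (prepend [a, a, a] x) := by
  intro h
  exact h.not_period_one 0 (by simp)

/-- After `a a`, the word `μ(y)` can only start with `b a a b b a`, where `b` is the complement
of `a`. -/
theorem OverlapFree.of_cons_cons_mu {a b : Bool} (h : OverlapFree (prepend [a, a] (mu y)))
    (hb : b = !a) : OverlapFree (prepend [b] y) ∧ y 0 = b ∧ y 1 = a ∧ y 2 = b := by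
  subst hb
  refine ⟨?_, ?_⟩
  · rw [prepend_cons] at h
    exact h.of_prepend.of_cons_mu rfl
  · have h1 := h.not_period_one 0
    have h2 := h.not_period_two 1
    have h3 := h.not_period_three 0
    simp only [zero_add, Nat.reduceAdd, prepend, mu, List.length_cons, List.length_nil] at h1 h2 h3
    generalize y 0 = c0 at *
    generalize y 1 = c1 at *
    generalize y 2 = c2 at *
    clear h
    revert a c0 c1 c2
    simp

/-- The word would start with `b a a b a a b`. -/
theorem not_overlapFree_cons_cons_cons_mu {a b : Bool} (hb : b = !a) :
    ¬ OverlapFree (prepend [b, a, a] (mu y)) := by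
  intro h
  have h' : OverlapFree (prepend [a, a] (mu y)) := by
    rw [prepend_cons] at h
    exact h.of_prepend
  obtain ⟨-, h0, h1, -⟩ := h'.of_cons_cons_mu hb
  refine h.not_period_three 0 ?_
  subst hb
  simp [prepend, mu, h0, h1]

end Prefixes

theorem prepend_prepend (l l' : List Bool) (x : ℕ → Bool) :
    prepend l (prepend l' x) = prepend (l ++ l') x := by
  induction l with
  | nil => simp
  | cons a l ih => rw [prepend_cons, ih, List.cons_append, ← prepend_cons]

theorem mu_zero (x : ℕ → Bool) : mu x 0 = x 0 := mu_two_mul x 0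

theorem mu_one (x : ℕ → Bool) : mu x 1 = !x 0 := mu_two_mul_add_one x 0

theorem mu_two (x : ℕ → Bool) : mu x 2 = x 1 := mu_two_mul x 1

theorem State.Holds.exists_next {s : State} {i : Fin 5} {y : ℕ → Bool}
    (h : s.Holds (prepend (p i) (mu y))) : ∃ s', s.next i = some s' ∧ s'.Holds y := by
  cases s <;> fin_cases i <;>
    simp [State.Holds, State.next, p, prepend_prepend, mu_zero, mu_one, mu_two,
      not_overlapFree_cons_cons_cons, not_overlapFree_cons_cons_cons_mu] at h ⊢
  all_goals first
    | exact h.of_mu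
    | exact h.of_cons_mu rfl
    | exact ⟨h.1.of_cons_mu rfl, h.2⟩
    | exact h.of_cons_not_cons_mu rfl
    | exact h.1.of_cons_not_cons_mu rfl
    | exact ⟨h.1.of_cons_not_cons_mu rfl, h.2⟩
    | exact h.of_cons_cons_mu rfl
    | exact h.1.of_cons_cons_mu rfl

theorem Code.Encodes.specified {c : Code} {x : ℕ → Bool} (hc : c.Encodes x)
    (hx : OverlapFree x) : c.Specified := by
  obtain ⟨y, h0, hy, ht⟩ := hc
  let q : ℕ → State := fun n => Nat.rec .A (fun n s => (s.next (c.index n)).getD .A) n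
  have hq : ∀ n, q (n + 1) = ((q n).next (c.index n)).getD .A := fun _ => rfl
  have holds : ∀ n, (q n).Holds (y n) := by
    intro n
    induction n with
    | zero => rwa [h0]
    | succ n ih =>
      rw [hy n] at ih
      obtain ⟨s, hs, h⟩ := ih.exists_next
      rw [hq, hs]
      exact h
  have path : ∀ n, (q n).next (c.index n) = some (q (n + 1)) := by
    intro n
    have := holds n
    rw [hy n] at this
    obtain ⟨s, hs, -⟩ := this.exists_next
    rw [hq, hs]
    rfl
  refine ⟨q, rfl, path, fun m hm => ?_⟩
  obtain ⟨a, ha⟩ := Option.isSome_iff_exists.1 (c.tail_isSome_iff.2 ⟨m, hm⟩)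
  have hy0 : y m 0 = a := (ht a ha m hm).2
  have hm' := holds m
  rw [ha, ← hy0]
  constructor
  · rintro (e | e) <;> rw [e] at hm' <;> exact congrArg some hm'.2
  · rintro (e | e) <;> rw [e] at hm' <;> exact congrArg some hm'.2

/-! ### Automatic words -/

theorem expansion_two_mul_add {n b : ℕ} (hb : b < 2) (h : 0 < 2 * n + b) :
    expansion 2 (2 * n + b) = expansion 2 n ++ [Fin.ofNat 2 b] := by
  have : Nat.digits 2 (2 * n + b) = b :: Nat.digits 2 n := by
    rw [add_comm]
    exact Nat.digits_add 2 one_lt_two b n hb (by omega)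
  simp [expansion, this]

/-- The word read by the automaton on `2 ^ j * n + r`, for `n > 0`, after it has read the expansion
of `n`, depends only on `j` and `r`. -/
theorem exists_expansion_two_pow_mul_add (j : ℕ) {r : ℕ} (hr : r < 2 ^ j) :
    ∃ w : List (Fin 2), ∀ n, 0 < n → expansion 2 (2 ^ j * n + r) = expansion 2 n ++ w := by
  induction j generalizing r with
  | zero =>
    obtain rfl : r = 0 := by simpa using hr
    exact ⟨[], fun n _ => by simp⟩
  | succ j ih =>
    obtain ⟨w, hw⟩ := ih (r := r / 2) (by rw [pow_succ] at hr; omega)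
    refine ⟨w ++ [Fin.ofNat 2 (r % 2)], fun n hn => ?_⟩
    have e : 2 ^ (j + 1) * n + r = 2 * (2 ^ j * n + r / 2) + r % 2 := by
      rw [pow_succ]
      have := Nat.div_add_mod r 2
      linarith
    rw [e, expansion_two_mul_add (Nat.mod_lt _ two_pos) (by positivity), hw n hn,
      List.append_assoc]

/-- The words that an automatic word has along the progressions `2 ^ j * n + r`, with
`r < 2 ^ (j + 1)`, are finitely many: such a word is determined by whether `r < 2 ^ j`, by the
action of the last `j` digits on the states, and by the first letter. -/
theorem IsAutomatic.finite_progressions {Δ : Type*} {x : ℕ → Δ} (h : IsAutomatic 2 x) :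
    {z : ℕ → Δ | ∃ j r, r < 2 ^ (j + 1) ∧ ∀ n, z n = x (2 ^ j * n + r)}.Finite := by
  obtain ⟨σ, hσ, M, hM⟩ := h
  -- `Δ` may be infinite, but only the outputs of the states matter.
  let f : Bool × (σ → σ) × σ → ℕ → Δ := fun t n =>
    if n = 0 ∧ t.1 = false then M.output t.2.2
    else M.output (t.2.1 ((expansion 2 (n + t.1.toNat)).foldl M.step M.start))
  refine (Set.finite_range f).subset ?_
  rintro z ⟨j, r, hr, hz⟩
  obtain ⟨c, s, hs, hcs⟩ : ∃ (c : Bool) (s : ℕ), s < 2 ^ j ∧ r = 2 ^ j * c.toNat + s := by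
    rcases Nat.lt_or_ge r (2 ^ j) with hlt | hge
    · exact ⟨false, r, hlt, by simp⟩
    · exact ⟨true, r - 2 ^ j, by rw [pow_succ] at hr; omega, by simp; omega⟩
  obtain ⟨w, hw⟩ := exists_expansion_two_pow_mul_add j hs
  refine ⟨(c, fun q => w.foldl M.step q, (expansion 2 s).foldl M.step M.start), ?_⟩
  funext n
  have e : 2 ^ j * n + r = 2 ^ j * (n + c.toNat) + s := by rw [hcs]; ring
  rw [hz, e, ← hM]
  simp only [f]
  split_ifs with h
  · obtain ⟨rfl, rfl⟩ := h
    simp [DFAO.eval]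
  · have : 0 < n + c.toNat := by
      cases c
      · simp at h ⊢; omega
      · simp
    rw [hw _ this, DFAO.eval, List.foldl_append]

/-- If `x` lies in a finite set `K` of words that is closed under taking the subwords at even and
at odd positions, then `x` is `2`-automatic. The states of the automaton are the maps `K → Bool`; the
state reached on the expansion of `n` is `z ↦ z n`, which can be updated digit by digit because
`z (2 n + b)` is the value at `n` of another word of `K`. -/
theorem isAutomatic_of_finite {x : ℕ → Bool} {K : Set (ℕ → Bool)} (hK : K.Finite) (hx : x ∈ K)
    (hclosed : ∀ z ∈ K, ∀ b < 2, (fun n => z (2 * n + b)) ∈ K) : IsAutomatic 2 x := by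
  have := hK.to_subtype
  let M : DFAO 2 Bool (K → Bool) :=
    { step := fun g b z => g ⟨_, hclosed z.1 z.2 b.1 b.2⟩
      start := fun z => z.1 0
      output := fun g => g ⟨x, hx⟩ }
  refine ⟨K → Bool, inferInstance, M, fun n => ?_⟩
  suffices (expansion 2 n).foldl M.step M.start = fun z => z.1 n by
    rw [DFAO.eval, this]
  induction n using Nat.strong_induction_on with
  | _ n ih =>
  rcases Nat.eq_zero_or_pos n with rfl | hn
  · simp [expansion, M]
  · have e := Nat.div_add_mod n 2
    rw [← e, expansion_two_mul_add (Nat.mod_lt _ two_pos) (by omega), List.foldl_append,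
      ih (n / 2) (by omega)]
    funext z
    simp [M, Fin.ofNat]

/-! ### Automatic words and ultimately periodic codes -/

theorem IsExpansion.exists_eq_progression {i : ℕ → Fin 5} {y : ℕ → ℕ → Bool}
    (h : IsExpansion i y) (j : ℕ) :
    ∃ r, r + 1 < 2 ^ (j + 1) ∧ ∀ n, y j n = y 0 (2 ^ j * n + r) := by
  induction j with
  | zero => exact ⟨0, by simp⟩
  | succ j ih =>
    obtain ⟨r, hr, hn⟩ := ih
    refine ⟨2 ^ j * (p (i j)).length + r, ?_, fun n => ?_⟩
    · have := Nat.mul_le_mul_left (2 ^ j) (length_p_le (i j))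
      rw [pow_succ _ (j + 1), pow_succ] at *
      omega
    · rw [← prepend_mu_two_mul_add (l := p (i j)) (y := y (j + 1)), ← h j, hn]
      congr 1
      ring

theorem IsExpansion.ultimatelyPeriodic {i : ℕ → Fin 5} {y : ℕ → ℕ → Bool}
    (h : IsExpansion i y) (h0 : OverlapFree (y 0)) (ha : IsAutomatic 2 (y 0)) :
    UltimatelyPeriodic i := by
  have hmaps : Set.MapsTo y Set.univ
      {z : ℕ → Bool | ∃ j r, r < 2 ^ (j + 1) ∧ ∀ n, z n = y 0 (2 ^ j * n + r)} := by
    intro j _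
    obtain ⟨r, hr, hn⟩ := h.exists_eq_progression j
    exact ⟨j, r, by omega, hn⟩
  obtain ⟨a, -, b, -, hab, e⟩ :=
    Set.infinite_univ.exists_lt_map_eq_of_mapsTo hmaps ha.finite_progressions
  obtain ⟨d, rfl⟩ := Nat.exists_eq_add_of_le hab.le
  have hy : ∀ k, y (a + k) = y (a + k + d) := by
    intro k
    induction k with
    | zero => exact e
    | succ k ih =>
      have := ((h.overlapFree h0 (a + k)).prepend_mu_inj (h _) (ih.trans (h _))).2
      rwa [show a + k + d + 1 = a + (k + 1) + d by ring] at this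
  refine ⟨a, d, by omega, fun n hn => ?_⟩
  obtain ⟨k, rfl⟩ := Nat.exists_eq_add_of_le hn
  exact (((h.overlapFree h0 (a + k)).prepend_mu_inj (h _) ((hy k).trans (h _))).1).symm

theorem IsExpansion.finite_range {i : ℕ → Fin 5} {y : ℕ → ℕ → Bool}
    (h : IsExpansion i y) (hp : UltimatelyPeriodic i) : (Set.range y).Finite := by
  obtain ⟨N, d, hd, hper⟩ := hp
  have e : (fun j => y (j + N)) = fun j => y (j + (N + d)) := by
    have hi : (fun j => i (j + (N + d))) = fun j => i (j + N) := funext fun j => by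
      rw [← add_assoc, hper _ (by omega)]
    have h2 := h.shift (N + d)
    rw [hi] at h2
    refine (h.shift N).unique h2 fun m hm => ?_
    have hm' : ZeroFrom i (m + N) := by
      intro n hn
      have : i (n - N + N) = 0 := hm (n - N) (by omega)
      rwa [Nat.sub_add_cancel (by omega)] at this
    have := h.add_eq_of_zeroFrom hm' d
    rw [show m + (N + d) = m + N + d by ring, this]
  refine ((Set.finite_Iio (N + d)).image y).subset ?_
  rintro _ ⟨j, rfl⟩
  induction j using Nat.strong_induction_on with
  | _ j ih =>
  rcases Nat.lt_or_ge j (N + d) with hj | hj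
  · exact ⟨j, hj, rfl⟩
  · have := congrFun e (j - (N + d))
    simp only [Nat.sub_add_cancel hj] at this
    rw [← this]
    exact ih _ (by omega)

/-- The finite set used consists of the words that are equal to some `y j` or its complement once at
most two letters at the beginning are deleted. -/
theorem IsExpansion.isAutomatic {i : ℕ → Fin 5} {y : ℕ → ℕ → Bool}
    (h : IsExpansion i y) (hfin : (Set.range y).Finite) : IsAutomatic 2 (y 0) := by
  let K : Set (ℕ → Bool) :=
    {z | ∃ (c : Bool) (k j : ℕ), k ≤ 2 ∧ ∀ n, z (n + k) = xor c (y j n)}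
  refine isAutomatic_of_finite (K := K) ?_ ⟨false, 0, 0, by simp⟩ ?_
  · let f : Set.range y × Bool × Fin 3 × Bool × Bool → ℕ → Bool := fun t n =>
      if n < t.2.2.1 then (if n = 0 then t.2.2.2.1 else t.2.2.2.2)
      else xor t.2.1 (t.1.1 (n - t.2.2.1))
    have := hfin.to_subtype
    refine (Set.finite_range f).subset ?_
    rintro z ⟨c, k, j, hk, hz⟩
    refine ⟨(⟨y j, j, rfl⟩, c, ⟨k, by omega⟩, z 0, z 1), ?_⟩
    funext n
    simp only [f]
    split_ifs with h1 h2
    · rw [h2]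
    · rw [show n = 1 by omega]
    · rw [← hz, Nat.sub_add_cancel (by omega)]
  · rintro z ⟨c, k, j, hk, hz⟩ b hb
    have hl := length_p_le (i j)
    set l := (p (i j)).length with hl'
    have hz0 : ∀ n, z (2 * n + (k + l)) = xor c (y (j + 1) n) := by
      intro n
      rw [show 2 * n + (k + l) = 2 * n + l + k by ring, hz, h j, hl', prepend_mu_two_mul_add]
    have hz1 : ∀ n, z (2 * n + (k + l) + 1) = xor (!c) (y (j + 1) n) := by
      intro n
      rw [show 2 * n + (k + l) + 1 = 2 * n + l + 1 + k by ring, hz, h j, hl',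
        prepend_mu_two_mul_add_one]
      simp
    -- The least `m` with `2 m + b ≥ k + l` exceeds `k + l` by `0` or `1`, according to parity.
    obtain ⟨m, hm, e | e⟩ : ∃ m ≤ 2, 2 * m + b = k + l ∨ 2 * m + b = k + l + 1 :=
      ⟨(k + l + 1 - b) / 2, by omega, by omega⟩
    · refine ⟨c, m, j + 1, hm, fun n => ?_⟩
      have e' : 2 * (n + m) + b = 2 * n + (k + l) := by omega
      simp only [e', hz0]
    · refine ⟨!c, m, j + 1, hm, fun n => ?_⟩
      have e' : 2 * (n + m) + b = 2 * n + (k + l) + 1 := by omega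
      simp only [e', hz1]

end OverlapFreeWords

theorem theorem8 (x : ℕ → Bool) (hx : OverlapFreeWords.OverlapFree x) :
    (∃! c : OverlapFreeWords.Code, c.Encodes x) ∧
      ∀ c : OverlapFreeWords.Code, c.Encodes x →
        (OverlapFreeWords.IsAutomatic 2 x ↔
          c.Specified ∧ OverlapFreeWords.UltimatelyPeriodic c.index) := by
  refine ⟨OverlapFreeWords.existsUnique_code hx, fun c hc => ?_⟩
  have hs := hc.specified hx
  obtain ⟨y, rfl, hy, -⟩ := hc
  have hy : OverlapFreeWords.IsExpansion c.index y := hy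
  exact ⟨fun ha => ⟨hs, hy.ultimatelyPeriodic hx ha⟩,
    fun ⟨_, hp⟩ => hy.isAutomatic (hy.finite_range hp)⟩
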